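/- Let $k$ be a field, $R = k[x_1,\dots,x_n]$ the polynomial ring in $n \ge 0$ variables, $\mathfrak m = (x_1,\dots,x_n)$, and let $I$ be a monomial ideal of $R$, i.e. an ideal generated by monomials. Call $I$ almost Cohen–Macaulay if $\operatorname{depth} R/I \ge \dim R/I - 1$, where $\dim$ is the Krull dimension and $\operatorname{depth} R/I$ is the supremum of the lengths of $R/I$-regular sequences contained in $\mathfrak m$. Then $I$ is almost Cohen–Macaulay if and only if $$\operatorname{ht}(I) \ge \operatorname{pd}_R(R/I) - 1,$$ where $\operatorname{ht}(I)$ is the height of $I$ and $\operatorname{pd}_R(R/I)$ is the projective dimension of $R/I$ as an $R$-module. (For $I = R$ the usual conventions $\dim 0 = \operatorname{pd}_R 0 = -\infty$ and $\operatorname{depth} 0 = \operatorname{ht}(R) = \infty$ are used.) -/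

import Mathlib

/-- An ideal of `k[x_1, …, x_n]` is a monomial ideal if it is generated by a set of monomials
`x^a`, `a ∈ ℕⁿ` (so `0` and the unit ideal are monomial ideals). -/
def IsMonomialIdeal {k : Type*} [Field k] {n : ℕ} (I : Ideal (MvPolynomial (Fin n) k)) : Prop :=
  ∃ S : Set (Fin n →₀ ℕ), I = Ideal.span ((fun a => MvPolynomial.monomial a (1 : k)) '' S)

open Classical in
/-- The depth of an `R`-module `M` with respect to an ideal `J`: the supremum of the lengths of
the `M`-regular sequences contained in `J`, and `∞` by convention if `J M = M`
(in particular if `M = 0`). -/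
noncomputable def moduleDepth {R : Type*} [CommRing R] (J : Ideal R) (M : Type*) [AddCommGroup M]
    [Module R M] : ℕ∞ :=
  if J • (⊤ : Submodule R M) = ⊤ then ⊤
  else ⨆ rs : {rs : List R // (∀ r ∈ rs, r ∈ J) ∧ RingTheory.Sequence.IsRegular M rs},
    (rs.1.length : ℕ∞)

/-- `I ⊆ R = k[x_1, …, x_n]` is almost Cohen–Macaulay if `depth R/I ≥ dim R/I - 1`, where the depth
is taken with respect to `(x_1, …, x_n)`.  The `1` is moved to the other side of the
inequality, to avoid subtraction in `WithBot ℕ∞`; `dim 0` is `⊥`. -/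
def IsAlmostCohenMacaulay {k : Type*} [Field k] {n : ℕ}
    (I : Ideal (MvPolynomial (Fin n) k)) : Prop :=
  ringKrullDim (MvPolynomial (Fin n) k ⧸ I) ≤
    (moduleDepth (MvPolynomial.idealOfVars (Fin n) k) (MvPolynomial (Fin n) k ⧸ I) :
      WithBot ℕ∞) + 1

-- For a proper monomial ideal, `ht I + dim R/I = n`: every prime over `I` contains a prime
-- generated by variables and containing `I`, and the smallest such set of variables computes both
-- numbers (`IsMonomialIdeal.exists_height_eq`). It then suffices to have Auslander–Buchsbaum as an
-- inequality: for `e ≤ n`, `pd M ≤ e` iff `depth M ≥ n - e`, applied with `e = ht I + 1`.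
--
-- Depth is read off from the vanishing of `Ext^i(k, M)` (Rees), and dimension shifting along a free
-- cover moves this condition against the projective dimension. The remaining case is depth `n`
-- implies projective. Localized at the irrelevant ideal, the ring has global dimension at most `n`,
-- and killing a regular sequence of length `n` raises projective dimension by `n`, so the localized
-- module is projective. Hence some `r` with nonzero constant term factors through a graded free
-- cover. The degree-zero part of that factorization replaces `r` by its constant term, a unit, and
-- so splits the cover.

universe u

/-! ### Global dimension of a Noetherian local ring -/

section GlobalDimension

open CategoryTheory Abelian IsLocalRing

variable {S : Type u} [CommRing S]

lemma ModuleCat.subsingleton_ext_of_linearEquiv {M N : ModuleCat.{u} S} (e : M ≃ₗ[S] N)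
    (L : ModuleCat.{u} S) (i : ℕ) (h : Subsingleton (Ext N L i)) : Subsingleton (Ext M L i) := by
  refine ⟨fun a b => ?_⟩
  rw [← a.mk₀_id_comp, ← b.mk₀_id_comp, ← e.toModuleIso.hom_inv_id, ← Ext.mk₀_comp_mk₀,
    Ext.comp_assoc_of_second_deg_zero, Ext.comp_assoc_of_second_deg_zero]
  congr 1
  exact Subsingleton.elim _ _

variable [IsNoetherianRing S]

/-- Dévissage: `M` is built by extensions from modules `S ⧸ p` with `p` in its support. Keeping
track of the support permits induction over larger primes. -/
lemma ModuleCat.subsingleton_ext_of_forall_support (L : ModuleCat.{u} S) (i : ℕ)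
    (Z : Set (PrimeSpectrum S))
    (hP : ∀ p ∈ Z, Subsingleton (Ext (ModuleCat.of S (S ⧸ p.asIdeal)) L i))
    (M : Type u) [AddCommGroup M] [Module S M] [hM : Module.Finite S M]
    (hZ : Module.support S M ⊆ Z) : Subsingleton (Ext (ModuleCat.of S M) L i) := by
  induction hM using IsNoetherianRing.induction_on_isQuotientEquivQuotientPrime S with
  | subsingleton N =>
    have hz : Limits.IsZero (ModuleCat.of S N) := ModuleCat.isZero_of_subsingleton _
    refine ⟨fun a b => ?_⟩
    have h0 : 𝟙 (ModuleCat.of S N) = 0 := hz.eq_of_src _ _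
    rw [← a.mk₀_id_comp, ← b.mk₀_id_comp, h0]
    simp
  | quotient N p e =>
    refine ModuleCat.subsingleton_ext_of_linearEquiv (N := ModuleCat.of S (S ⧸ p.asIdeal)) e _ _
      (hP p (hZ ?_))
    rw [e.support_eq, Module.support_eq_zeroLocus, Ideal.annihilator_quotient]
    simp [PrimeSpectrum.mem_zeroLocus]
  | exact N₁ N₂ N₃ f g hf hg hfg h₁ h₃ =>
    rw [Module.support_of_exact hfg hf hg] at hZ
    have h₁' := h₁ (Set.subset_union_left.trans hZ)
    have h₃' := h₃ (Set.subset_union_right.trans hZ)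
    let T : ShortComplex (ModuleCat.{u} S) :=
      ShortComplex.mk (ModuleCat.ofHom f) (ModuleCat.ofHom g)
        (by rw [← ModuleCat.ofHom_comp, hfg.linearMap_comp_eq_zero]; rfl)
    have hT : T.ShortExact := 
      { exact := (ShortComplex.ShortExact.moduleCat_exact_iff_function_exact _).mpr hfg
        mono_f := (ModuleCat.mono_iff_injective _).mpr hf
        epi_g := (ModuleCat.epi_iff_surjective _).mpr hg }
    have key : ∀ a : Ext T.X₂ L i, a = 0 := by
      intro a
      obtain ⟨x₃, rfl⟩ := Ext.contravariant_sequence_exact₂ hT _ a (h₁'.elim _ _)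
      rw [h₃'.elim x₃ 0, Ext.comp_zero]
    exact ⟨fun a b => (key a).trans (key b).symm⟩

variable [IsLocalRing S]

/-- If `x` is an `M`-regular element of the maximal ideal and `Ext^{i+1}(M/xM, L)` vanishes, then
so does `Ext^i(M, L)`. -/
lemma ModuleCat.subsingleton_ext_of_quotSMulTop (M L : ModuleCat.{u} S) [Module.Finite S M]
    [Module.Finite S L] (x : S) (reg : IsSMulRegular M x) (mem : x ∈ maximalIdeal S) (i : ℕ)
    (zero : Subsingleton (Ext (ModuleCat.of S (QuotSMulTop x M)) L (i + 1))) :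
    Subsingleton (Ext M L i) := by
  have hS := reg.smulShortComplex_shortExact
  have exac := Ext.contravariant_sequence_exact₁' hS L i (i + 1) (add_comm 1 i)
  have epi := exac.epi_f ((@AddCommGrpCat.isZero_of_subsingleton _ zero).eq_zero_of_tgt _)
  simp only [AddCommGrpCat.epi_iff_surjective, AddCommGrpCat.hom_ofHom] at epi
  -- Nakayama: multiplication by `x` is onto the finitely generated module `Ext M L i`.
  by_contra! ntr
  have : x ∈ (Module.annihilator S (Ext M L i)).jacobson :=
    (IsLocalRing.maximalIdeal_le_jacobson _) mem
  absurd Submodule.top_ne_pointwise_smul_of_mem_jacobson_annihilator this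
  rw [eq_comm, eq_top_iff]
  intro y hy
  rcases epi y with ⟨z, hz⟩
  have hxz (w : Ext M L i) : (Ext.mk₀ (x • 𝟙 M)).comp w (zero_add i) = x • w := by
    rw [Ext.mk₀_smul, Ext.smul_comp, Ext.mk₀_id_comp]
  have hz' : (Ext.mk₀ (x • 𝟙 M)).comp z (zero_add i) = y := hz
  exact (hz'.symm.trans (hxz z)) ▸ Submodule.smul_mem_pointwise_smul _ _ ⊤ trivial

/-- Over a Noetherian local ring, the projective dimension of a finitely generated module is at
most that of the residue field. -/
theorem ModuleCat.hasProjectiveDimensionLE_of_residueField (n : ℕ)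
    (h : HasProjectiveDimensionLE (ModuleCat.of S (S ⧸ maximalIdeal S)) n)
    (M : ModuleCat.{u} S) [Module.Finite S M] : HasProjectiveDimensionLE M n := by
  -- Noetherian induction from the larger primes: for `x` in the maximal ideal but not in `p`, the
  -- quotient of `S ⧸ p` by `x` is supported on primes strictly above `p`. Finiteness of `L` is
  -- needed for Nakayama.
  have key : ∀ p : PrimeSpectrum S, ∀ L : ModuleCat.{u} S, Module.Finite S L → ∀ i, n < i →
      Subsingleton (Ext (ModuleCat.of S (S ⧸ p.asIdeal)) L i) := by
    rintro ⟨p, hpp⟩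
    induction p using WellFoundedGT.induction with
    | ind p ih =>
      intro L _ i hi
      dsimp only
      by_cases hp : p = maximalIdeal S
      · subst hp
        exact HasProjectiveDimensionLT.subsingleton _ (n + 1) i hi L
      · obtain ⟨x, hx, hxp⟩ := SetLike.exists_of_lt
          (lt_of_le_of_ne (le_maximalIdeal hpp.ne_top) hp)
        have reg : IsSMulRegular (S ⧸ p) x := by
          rw [isSMulRegular_iff_right_eq_zero_of_smul]
          intro y hy
          obtain ⟨y, rfl⟩ := Ideal.Quotient.mk_surjective y
          have : Ideal.Quotient.mk p (x * y) = 0 := hy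
          rw [Ideal.Quotient.eq_zero_iff_mem] at this ⊢
          exact (hpp.mem_or_mem this).resolve_left hxp
        refine ModuleCat.subsingleton_ext_of_quotSMulTop _ L x reg hx i ?_
        refine ModuleCat.subsingleton_ext_of_forall_support L (i + 1) {q | p < q.asIdeal}
          (fun q hq => ih q.1 hq q.2 L inferInstance _ (by omega)) _ ?_
        rw [Module.support_quotSMulTop, Module.support_eq_zeroLocus, Ideal.annihilator_quotient]
        rintro q ⟨hq, hq'⟩
        simp only [PrimeSpectrum.mem_zeroLocus, SetLike.coe_subset_coe,
          Set.singleton_subset_iff] at hq hq'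
        exact lt_of_le_of_ne hq (fun h => hxp (h ▸ hq'))
  refine hasProjectiveDimensionLT_of_forall_finite M (n + 1) fun L _ => ?_
  exact ModuleCat.subsingleton_ext_of_forall_support L (n + 1) Set.univ
    (fun p _ => key p L inferInstance _ (by omega)) M (Set.subset_univ _)

end GlobalDimension

/-! ### The variables as a regular sequence -/

section Variables

open MvPolynomial RingTheory.Sequence

variable {k : Type u} [Field k] {n : ℕ}

/-- If a variable other than `X i` divides `X i * m`, it divides the monomial `m`. -/
lemma MvPolynomial.mem_span_X_image_of_X_mul_mem {σ : Type*} {s : Set σ} {i : σ} (hi : i ∉ s)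
    {f : MvPolynomial σ k} (h : X i * f ∈ Ideal.span (X '' s : Set (MvPolynomial σ k))) :
    f ∈ Ideal.span (X '' s : Set (MvPolynomial σ k)) := by
  rw [mem_ideal_span_X_image] at h ⊢
  intro m hm
  obtain ⟨j, hj, hne⟩ := h (Finsupp.single i 1 + m) (by
    rw [mem_support_iff] at hm ⊢
    rwa [coeff_X_mul])
  refine ⟨j, hj, ?_⟩
  have hij : i ≠ j := fun h => hi (h ▸ hj)
  simpa [Finsupp.single_apply, hij] using hne

variable (k n) in
/-- The list of all variables of `k[x_1, …, x_n]`. -/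
noncomputable def MvPolynomial.listX : List (MvPolynomial (Fin n) k) :=
  (List.finRange n).map X

lemma MvPolynomial.length_listX : (listX k n).length = n := by simp [listX]

lemma MvPolynomial.mem_listX {p : MvPolynomial (Fin n) k} : p ∈ listX k n ↔ ∃ i, X i = p := by
  simp [listX]

lemma MvPolynomial.ofList_listX : Ideal.ofList (listX k n) = idealOfVars (Fin n) k := by
  rw [Ideal.ofList, idealOfVars]
  congr 1
  ext p
  simp [mem_listX]

lemma MvPolynomial.listX_mem {p : MvPolynomial (Fin n) k} (h : p ∈ listX k n) :
    p ∈ idealOfVars (Fin n) k :=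
  ofList_listX (k := k) (n := n) ▸ Ideal.subset_span h

lemma MvPolynomial.mem_idealOfVars_iff {p : MvPolynomial (Fin n) k} :
    p ∈ idealOfVars (Fin n) k ↔ constantCoeff p = 0 := by
  rw [idealOfVars, ← Set.image_univ, mem_ideal_span_X_image, constantCoeff_eq]
  constructor
  · intro h
    by_contra h0
    obtain ⟨i, -, hi⟩ := h 0 (mem_support_iff.mpr h0)
    exact hi rfl
  · intro h m hm
    have : m ≠ 0 := by
      rintro rfl
      exact mem_support_iff.mp hm h
    obtain ⟨i, hi⟩ := Finsupp.ne_iff.mp this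
    exact ⟨i, trivial, hi⟩

lemma MvPolynomial.ker_constantCoeff :
    RingHom.ker (constantCoeff : MvPolynomial (Fin n) k →+* k) = idealOfVars (Fin n) k := by
  ext p
  rw [mem_idealOfVars_iff, RingHom.mem_ker]

instance MvPolynomial.isMaximal_idealOfVars : (idealOfVars (Fin n) k).IsMaximal := by
  rw [← ker_constantCoeff]
  exact RingHom.ker_isMaximal_of_surjective _ (fun c => ⟨C c, constantCoeff_C _ c⟩)

lemma MvPolynomial.isWeaklyRegular_listX :
    IsWeaklyRegular (MvPolynomial (Fin n) k) (listX k n) := by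
  refine ⟨fun i hi => ?_⟩
  have hin : i < n := by simpa [length_listX] using hi
  have hi' : (listX k n)[i] = X ⟨i, hin⟩ := by simp [listX]
  have hI : (Ideal.ofList ((listX k n).take i) • ⊤ :
      Submodule (MvPolynomial (Fin n) k) (MvPolynomial (Fin n) k)) =
      Ideal.span (X '' {j : Fin n | j.1 < i}) := by
    rw [smul_eq_mul, Ideal.mul_top, Ideal.ofList]
    congr 1
    ext p
    simp only [listX, List.mem_take_iff_getElem, Set.mem_ofPred_eq, Set.mem_image]
    constructor
    · rintro ⟨j, hj, rfl⟩
      simp only [List.length_map, List.length_finRange, lt_inf_iff] at hj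
      exact ⟨⟨j, hj.2⟩, hj.1, by simp⟩
    · rintro ⟨j, hj, rfl⟩
      exact ⟨j.1, by simp [hj], by simp⟩
  rw [hi', hI, isSMulRegular_iff_right_eq_zero_of_smul]
  intro y hy
  obtain ⟨y, rfl⟩ := Submodule.mkQ_surjective _ y
  rw [← map_smul, Submodule.mkQ_apply, Submodule.Quotient.mk_eq_zero, smul_eq_mul] at hy
  rw [Submodule.mkQ_apply, Submodule.Quotient.mk_eq_zero]
  exact mem_span_X_image_of_X_mul_mem (by simp) hy

end Variables

/-! ### Localization at the irrelevant ideal -/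

section Localization

open MvPolynomial RingTheory.Sequence CategoryTheory IsLocalRing

variable {k : Type u} [Field k] {n : ℕ}

/-- The residue field is the quotient by the `n` variables, still a weakly regular sequence, so it
has projective dimension `n`, which bounds all the others. -/
lemma MvPolynomial.hasProjectiveDimensionLE_localization
    (M : ModuleCat.{u} (Localization.AtPrime (idealOfVars (Fin n) k)))
    [Module.Finite (Localization.AtPrime (idealOfVars (Fin n) k)) M] :
    HasProjectiveDimensionLE M n := by
  set S := Localization.AtPrime (idealOfVars (Fin n) k)
  have : IsNoetherianRing S := IsLocalization.isNoetherianRing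
    (idealOfVars (Fin n) k).primeCompl _ inferInstance
  refine ModuleCat.hasProjectiveDimensionLE_of_residueField n ?_ M
  have h1 : (Ideal.ofList ((listX k n).map (algebraMap _ S)) • ⊤ : Submodule S S) =
      maximalIdeal S := by
    rw [smul_eq_mul, Ideal.mul_top, ← Ideal.map_ofList, ofList_listX]
    exact Localization.AtPrime.map_eq_maximalIdeal
  have h2 := ModuleCat.projectiveDimension_quotient_eq_add_length_of_isWeaklyRegular
    (ModuleCat.of S S) ((listX k n).map (algebraMap _ S))
    (isWeaklyRegular_listX.of_isLocalization S (idealOfVars (Fin n) k).primeCompl) (by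
      intro r hr
      obtain ⟨x, hx, rfl⟩ := List.mem_map.mp hr
      exact (IsLocalization.AtPrime.to_map_mem_maximal_iff S (idealOfVars (Fin n) k) x).mpr
        (listX_mem hx))
  have h0 : projectiveDimension (ModuleCat.of S S) = 0 :=
    ModuleCat.projectiveDimension_eq_zero_of_projective _
  rw [h0, zero_add, List.length_map, length_listX] at h2
  rw [← projectiveDimension_le_iff, ← h2]
  exact (projectiveDimension_eq_of_iso (Submodule.quotEquivOfEq _ _ h1).toModuleIso).ge

/-- A finitely generated module over `k[x_1, …, x_n]` admitting a regular sequence of length `n`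
inside the irrelevant ideal is projective locally at the irrelevant ideal. -/
lemma MvPolynomial.projective_localizedModule (M : Type u) [AddCommGroup M]
    [Module (MvPolynomial (Fin n) k) M] [Module.Finite (MvPolynomial (Fin n) k) M]
    (rs : List (MvPolynomial (Fin n) k)) (hlen : rs.length = n)
    (hmem : ∀ r ∈ rs, r ∈ idealOfVars (Fin n) k) (reg : IsWeaklyRegular M rs) :
    Module.Projective (Localization.AtPrime (idealOfVars (Fin n) k))
      (LocalizedModule (idealOfVars (Fin n) k).primeCompl M) := by
  set S := Localization.AtPrime (idealOfVars (Fin n) k)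
  set N := LocalizedModule (idealOfVars (Fin n) k).primeCompl M
  have : IsNoetherianRing S := IsLocalization.isNoetherianRing
    (idealOfVars (Fin n) k).primeCompl _ inferInstance
  have : Module.Finite S N := inferInstance
  rcases subsingleton_or_nontrivial N with hN | hN
  · infer_instance
  have h2 := ModuleCat.projectiveDimension_quotient_eq_add_length_of_isWeaklyRegular
    (ModuleCat.of S N) (rs.map (algebraMap _ S))
    (reg.of_isLocalizedModule S (idealOfVars (Fin n) k).primeCompl
      (LocalizedModule.mkLinearMap (idealOfVars (Fin n) k).primeCompl M)) (by
      intro r hr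
      obtain ⟨x, hx, rfl⟩ := List.mem_map.mp hr
      exact (IsLocalization.AtPrime.to_map_mem_maximal_iff S (idealOfVars (Fin n) k) x).mpr
        (hmem _ hx))
  rw [List.length_map, hlen] at h2
  have h3 := (projectiveDimension_le_iff _ _).mpr (hasProjectiveDimensionLE_localization
    (ModuleCat.of S (N ⧸ Ideal.ofList (rs.map (algebraMap _ S)) • (⊤ : Submodule S N))))
  rw [h2] at h3
  -- From `pd N + n ≤ n`, by cancelling the finite `n`.
  have h4 : projectiveDimension (ModuleCat.of S N) ≤ 0 := by
    have := ENat.WithBot.add_le_add_natCast_right_iff (a := projectiveDimension (ModuleCat.of S N))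
      (b := 0) (c := n)
    rw [zero_add] at this
    exact this.mp h3
  have h5 := (projectiveDimension_le_iff _ 0).mp h4
  have : Projective (ModuleCat.of S N) := (projective_iff_hasProjectiveDimensionLE_zero _).mpr h5
  exact IsProjective.iff_projective _ |>.mpr this

/-- If `M` is projective locally at a prime `p`, then for every surjection `f` onto `M` some scalar
outside of `p` factors through `f`. -/
lemma Module.exists_comp_eq_smul_of_projective_localizedModule {R : Type*} [CommRing R]
    (p : Ideal R) [p.IsPrime] {F M : Type*} [AddCommGroup F] [Module R F] [AddCommGroup M]
    [Module R M] [Module.FinitePresentation R M] (f : F →ₗ[R] M) (hf : Function.Surjective f)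
    [Module.Projective (Localization.AtPrime p) (LocalizedModule p.primeCompl M)] :
    ∃ r ∉ p, ∃ g : M →ₗ[R] F, f ∘ₗ g = r • LinearMap.id := by
  let T := p.primeCompl
  obtain ⟨s, hs⟩ := Module.projective_lifting_property (LocalizedModule.map T f) LinearMap.id
    (LocalizedModule.map_surjective T f hf)
  -- Finite presentation lifts the local section up to a denominator `t`; a second denominator makes
  -- the identity hold before localizing.
  obtain ⟨h, t, ht⟩ := Module.FinitePresentation.exists_lift_of_isLocalizedModule T
    (LocalizedModule.mkLinearMap T F) (s.restrictScalars R ∘ₗ LocalizedModule.mkLinearMap T M)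
  have hcomp : LocalizedModule.mkLinearMap T M ∘ₗ (f ∘ₗ h) =
      LocalizedModule.mkLinearMap T M ∘ₗ (t.1 • LinearMap.id) := by
    ext x
    have h1 := congr(LocalizedModule.map T f ($ht x))
    have h2 := congr($hs (LocalizedModule.mkLinearMap T M x))
    simp only [LinearMap.coe_comp, Function.comp_apply, LinearMap.id_apply,
      LocalizedModule.mkLinearMap_apply, LinearMap.smul_apply, LinearMap.coe_restrictScalars,
      LocalizedModule.map_mk] at h1 h2 ⊢
    rw [h1]
    have h3 : t • s (LocalizedModule.mk x 1) = t.1 • s (LocalizedModule.mk x 1) := rfl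
    rw [h3, LinearMap.map_smul_of_tower, h2, LocalizedModule.smul'_mk]
  obtain ⟨s', hs'⟩ := Module.Finite.exists_smul_of_comp_eq_of_isLocalizedModule T
    (LocalizedModule.mkLinearMap T M) _ _ hcomp
  refine ⟨s'.1 * t.1, (s' * t).2, s'.1 • h, ?_⟩
  rw [LinearMap.comp_smul, mul_smul]
  exact hs'

end Localization

/-! ### Graded modules and the degree-zero part of a map -/

section Gradings

open MvPolynomial Finset

variable {k : Type u} [Field k] {σ : Type*}

/-- An `ℕ`-grading of a module over a polynomial ring in its standard grading, given by the
projections onto the homogeneous components. -/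
structure MvPolynomial.Grading (k : Type*) [Field k] (σ : Type*) (M : Type*) [AddCommGroup M]
    [Module (MvPolynomial σ k) M] where
  comp : ℕ → M →+ M
  comp_comp : ∀ a b m, comp a (comp b m) = if a = b then comp b m else 0
  exists_sum : ∀ m, ∃ N, ∀ N' ≥ N, ∑ a ∈ range N', comp a m = m
  comp_C : ∀ a c m, comp a ((C c : MvPolynomial σ k) • m) = (C c : MvPolynomial σ k) • comp a m
  comp_succ_X : ∀ a i m,
    comp (a + 1) ((X i : MvPolynomial σ k) • m) = (X i : MvPolynomial σ k) • comp a m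
  comp_zero_X : ∀ i m, comp 0 ((X i : MvPolynomial σ k) • m) = 0

namespace MvPolynomial.Grading

variable {M : Type*} [AddCommGroup M] [Module (MvPolynomial σ k) M]

lemma exists_comp_eq_zero (G : Grading k σ M) (m : M) : ∃ N, ∀ a ≥ N, G.comp a m = 0 := by
  obtain ⟨N, hN⟩ := G.exists_sum m
  refine ⟨N, fun a ha => ?_⟩
  have h1 := hN (a + 1) (by omega)
  rwa [sum_range_succ, hN a ha, add_eq_left] at h1

variable (k σ) in
/-- The polynomial ring with its standard grading, shifted by `d`. -/
noncomputable def shift (d : ℕ) : Grading k σ (MvPolynomial σ k) where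
  comp a := if d ≤ a then (homogeneousComponent (a - d)).toAddMonoidHom else 0
  comp_comp a b m := by
    by_cases hb : d ≤ b <;> by_cases ha : d ≤ a
    · ext x
      simp only [ha, hb, if_true, LinearMap.toAddMonoidHom_coe, coeff_homogeneousComponent]
      have : a - d = b - d ↔ a = b := by omega
      split_ifs <;> simp_all [coeff_homogeneousComponent]
    · have : a ≠ b := by omega
      simp [ha, this]
    · simp [hb]
    · simp [hb]
  exists_sum m := by
    refine ⟨d + m.totalDegree + 1, fun N' hN' => ?_⟩
    ext x
    rw [coeff_sum]
    have hterm (a : ℕ) : coeff x ((if d ≤ a then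
        (homogeneousComponent (a - d) : MvPolynomial σ k →ₗ[k] _).toAddMonoidHom else 0) m) =
        if x.degree + d = a then coeff x m else 0 := by
      by_cases ha : d ≤ a
      · simp only [ha, if_true, LinearMap.toAddMonoidHom_coe, coeff_homogeneousComponent]
        congr 1
        simp only [eq_iff_iff]
        omega
      · have : x.degree + d ≠ a := by omega
        simp [ha, this]
    simp only [hterm, sum_ite_eq, mem_range]
    split_ifs with h
    · rfl
    · symm
      by_contra hx
      have := le_totalDegree (mem_support_iff.mpr hx)
      change x.degree ≤ _ at this
      omega
  comp_C a c m := by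
    split_ifs
    · simp only [smul_eq_mul, LinearMap.toAddMonoidHom_coe, ← smul_eq_C_mul, map_smul]
    · simp
  comp_succ_X a i m := by
    classical
    by_cases ha : d ≤ a
    · have h1 : d ≤ a + 1 := by omega
      simp only [ha, h1, if_true, LinearMap.toAddMonoidHom_coe, smul_eq_mul]
      ext x
      simp only [coeff_homogeneousComponent, coeff_X_mul']
      by_cases hx : i ∈ x.support
      · have hle : Finsupp.single i 1 ≤ x := by
          simpa [Nat.one_le_iff_ne_zero] using hx
        obtain ⟨y, rfl⟩ := exists_add_of_le hle
        simp only [hx, if_true, add_tsub_cancel_left, map_add, Finsupp.degree_single]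
        congr 1
        simp only [eq_iff_iff]
        omega
      · simp [hx]
    · by_cases h1 : d ≤ a + 1
      · have h2 : a + 1 - d = 0 := by omega
        simp [ha, h1, h2, homogeneousComponent_zero, ← constantCoeff_eq]
      · simp [ha, h1]
  comp_zero_X i m := by
    by_cases h : d ≤ 0
    · simp [h, homogeneousComponent_zero, ← constantCoeff_eq]
    · simp [h]

lemma shift_comp_one (d a : ℕ) : (shift k σ d).comp a 1 = if a = d then 1 else 0 := by
  by_cases h : d ≤ a
  · have : a - d = 0 ↔ a = d := by omega
    have h1 : (1 : MvPolynomial σ k).IsHomogeneous 0 := isHomogeneous_one _ _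
    simp only [shift, h, if_true, LinearMap.toAddMonoidHom_coe]
    rw [homogeneousComponent_of_mem h1]
    split_ifs <;> first | rfl | omega
  · have : a ≠ d := by omega
    simp [shift, h, this]

lemma shift_comp_self (d : ℕ) (p : MvPolynomial σ k) :
    (shift k σ d).comp d p = C (constantCoeff p) := by
  simp [shift, homogeneousComponent_zero, constantCoeff_eq]

/-- The components of a multiple of a homogeneous element. -/
lemma comp_smul_of_comp_eq (G : Grading k σ M) {d : ℕ} {w : M} (hw : G.comp d w = w)
    (r : MvPolynomial σ k) (a : ℕ) : G.comp a (r • w) = (shift k σ d).comp a r • w := by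
  induction r using MvPolynomial.induction_on generalizing a with
  | C c =>
    have h1 := (shift k σ d).comp_C a c 1
    rw [smul_eq_mul, mul_one, smul_eq_mul, shift_comp_one] at h1
    rw [G.comp_C, h1, ← hw, G.comp_comp]
    split_ifs <;> simp [hw]
  | add p q hp hq => rw [add_smul, map_add, map_add, add_smul, hp, hq]
  | mul_X p i hp =>
    rw [mul_comm, mul_smul, ← smul_eq_mul]
    cases a with
    | zero => rw [G.comp_zero_X, comp_zero_X, zero_smul]
    | succ a => rw [G.comp_succ_X, comp_succ_X, hp, smul_assoc]

/-- The grading of a finite free module with basis vectors in prescribed degrees. -/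
noncomputable def pi {ι : Type*} [Fintype ι] (d : ι → ℕ) :
    Grading k σ (ι → MvPolynomial σ k) where
  comp a := AddMonoidHom.pi fun i => ((shift k σ (d i)).comp a).comp (Pi.evalAddMonoidHom _ i)
  comp_comp a b m := by
    ext1 i
    simp only [AddMonoidHom.pi_apply, AddMonoidHom.comp_apply, Pi.evalAddMonoidHom_apply, comp_comp]
    split_ifs <;> simp
  exists_sum m := by
    choose N hN using fun i => (shift k σ (d i)).exists_sum (m i)
    refine ⟨univ.sup N, fun N' hN' => ?_⟩
    ext1 i
    rw [Finset.sum_apply]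
    exact hN i N' ((le_sup (mem_univ i)).trans hN')
  comp_C a c m := by
    ext1 i
    exact (shift k σ (d i)).comp_C a c (m i)
  comp_succ_X a j m := by
    ext1 i
    exact (shift k σ (d i)).comp_succ_X a j (m i)
  comp_zero_X j m := by
    ext1 i
    exact (shift k σ (d i)).comp_zero_X j (m i)

variable {F : Type*} [AddCommGroup F] [Module (MvPolynomial σ k) F]

/-- The grading of the kernel of a graded linear map. -/
noncomputable def ker (GF : Grading k σ F) (GM : Grading k σ M) (f : F →ₗ[MvPolynomial σ k] M)
    (hf : ∀ a v, f (GF.comp a v) = GM.comp a (f v)) : Grading k σ (LinearMap.ker f) where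
  comp a := ((GF.comp a).comp (LinearMap.ker f).subtype.toAddMonoidHom).codRestrict
    (LinearMap.ker f).toAddSubgroup (fun v => by
      have := v.2
      rw [LinearMap.mem_ker] at this
      simp [hf, this])
  comp_comp a b m := by
    ext1
    refine (GF.comp_comp a b m).trans ?_
    split_ifs <;> rfl
  exists_sum m := by
    obtain ⟨N, hN⟩ := GF.exists_sum m
    refine ⟨N, fun N' hN' => ?_⟩
    ext1
    rw [AddSubmonoidClass.coe_finsetSum]
    exact hN N' hN'
  comp_C a c m := Subtype.ext (GF.comp_C a c m)
  comp_succ_X a i m := Subtype.ext (GF.comp_succ_X a i m)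
  comp_zero_X i m := Subtype.ext (GF.comp_zero_X i m)

/-- A finitely generated graded module is the image of a graded finite free module under a graded
linear map. -/
lemma exists_free_cover {M : Type u} [AddCommGroup M] [Module (MvPolynomial σ k) M]
    [Module.Finite (MvPolynomial σ k) M] (G : Grading k σ M) :
    ∃ (ι : Type u) (_ : Fintype ι) (d : ι → ℕ)
      (f : (ι → MvPolynomial σ k) →ₗ[MvPolynomial σ k] M),
      Function.Surjective f ∧ ∀ a v, f ((pi d).comp a v) = G.comp a (f v) := by
  obtain ⟨t, ht⟩ := Module.Finite.fg_top (R := MvPolynomial σ k) (M := M)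
  choose N hN using G.exists_sum
  let g : t × Fin (t.sup N) → M := fun i => G.comp i.2 i.1
  refine ⟨t × Fin (t.sup N), inferInstance, fun i => i.2, Fintype.linearCombination _ g, ?_, ?_⟩
  · rw [← LinearMap.range_eq_top, Fintype.range_linearCombination, ← top_le_iff, ← ht,
      Submodule.span_le]
    intro m hm
    rw [SetLike.mem_coe, ← hN m (t.sup N) (le_sup hm)]
    refine Submodule.sum_mem _ fun a ha => Submodule.subset_span ?_
    exact ⟨(⟨m, hm⟩, ⟨a, mem_range.mp ha⟩), rfl⟩
  · intro a v
    simp only [Fintype.linearCombination_apply, map_sum]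
    refine sum_congr rfl fun i _ => ?_
    rw [G.comp_smul_of_comp_eq (d := i.2) (by simp [g, G.comp_comp])]
    rfl

variable (GF : Grading k σ F) (GM : Grading k σ M)

/-- The components of `u` vanish in large degrees. Allowing every large `N'` lets several elements
share one range. -/
lemma finsum_comp_eq (g : M →ₗ[MvPolynomial σ k] F) (u : M) :
    ∃ N, ∀ N' ≥ N, ∑ᶠ a, GF.comp a (g (GM.comp a u)) =
      ∑ a ∈ range N', GF.comp a (g (GM.comp a u)) := by
  obtain ⟨N, hN⟩ := GM.exists_comp_eq_zero u
  refine ⟨N, fun N' hN' => finsum_eq_sum_of_support_subset _ fun a ha => ?_⟩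
  rw [mem_coe, mem_range]
  by_contra h
  exact ha (by simp [hN a (by omega)])

/-- The degree zero part of a linear map between graded modules. -/
noncomputable def degreeZero (g : M →ₗ[MvPolynomial σ k] F) : M →ₗ[MvPolynomial σ k] F :=
  have hadd (u v : M) : ∑ᶠ a, GF.comp a (g (GM.comp a (u + v))) =
      ∑ᶠ a, GF.comp a (g (GM.comp a u)) + ∑ᶠ a, GF.comp a (g (GM.comp a v)) := by
    obtain ⟨N₁, h₁⟩ := finsum_comp_eq GF GM g u
    obtain ⟨N₂, h₂⟩ := finsum_comp_eq GF GM g v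
    obtain ⟨N₃, h₃⟩ := finsum_comp_eq GF GM g (u + v)
    rw [h₁ (max N₁ (max N₂ N₃)) (by omega), h₂ (max N₁ (max N₂ N₃)) (by omega),
      h₃ (max N₁ (max N₂ N₃)) (by omega), ← sum_add_distrib]
    simp
  { toFun := fun u => ∑ᶠ a, GF.comp a (g (GM.comp a u))
    map_add' := hadd
    map_smul' := fun r u => by
      rw [RingHom.id_apply]
      induction r using MvPolynomial.induction_on generalizing u with
      | C c =>
        obtain ⟨N₁, h₁⟩ := finsum_comp_eq GF GM g u
        obtain ⟨N₂, h₂⟩ := finsum_comp_eq GF GM g ((C c : MvPolynomial σ k) • u)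
        rw [h₁ (max N₁ N₂) (by omega), h₂ (max N₁ N₂) (by omega), smul_sum]
        simp only [GM.comp_C, map_smul, GF.comp_C]
      | add p q hp hq => rw [add_smul, hadd, hp, hq, add_smul]
      | mul_X p i hp =>
        rw [mul_smul, hp, mul_smul]
        congr 1
        obtain ⟨N₁, h₁⟩ := finsum_comp_eq GF GM g u
        obtain ⟨N₂, h₂⟩ := finsum_comp_eq GF GM g ((X i : MvPolynomial σ k) • u)
        -- `X i` raises degrees by one, so one more summand is taken; the new degree-zero term
        -- vanishes.
        rw [h₁ (max N₁ N₂) (by omega), h₂ (max N₁ N₂ + 1) (by omega), smul_sum, sum_range_succ']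
        simp only [GM.comp_zero_X, map_zero, add_zero, GM.comp_succ_X, map_smul, GF.comp_succ_X] }

lemma degreeZero_apply (g : M →ₗ[MvPolynomial σ k] F) (u : M) :
    degreeZero GF GM g u = ∑ᶠ a, GF.comp a (g (GM.comp a u)) := rfl

/-- A graded module is projective if multiplication by some polynomial with nonzero constant
term factors through a graded projective cover. -/
lemma projective_of_comp_eq_smul [Module.Projective (MvPolynomial σ k) F]
    (f : F →ₗ[MvPolynomial σ k] M) (hf : ∀ a v, f (GF.comp a v) = GM.comp a (f v))
    (g : M →ₗ[MvPolynomial σ k] F) (r : MvPolynomial σ k) (hr : constantCoeff r ≠ 0)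
    (hg : f ∘ₗ g = r • LinearMap.id) : Module.Projective (MvPolynomial σ k) M := by
  refine Module.Projective.of_split
    ((C (constantCoeff r)⁻¹ : MvPolynomial σ k) • degreeZero GF GM g) f ?_
  ext u
  have h (v : M) : f (g v) = r • v := congr($hg v)
  obtain ⟨N₁, h₁⟩ := finsum_comp_eq GF GM g u
  obtain ⟨N₂, h₂⟩ := GM.exists_sum u
  simp only [LinearMap.comp_apply, LinearMap.smul_apply, map_smul, LinearMap.id_apply]
  rw [degreeZero_apply, h₁ (max N₁ N₂) (by omega), map_sum]
  -- As `f` is graded, this is the degree-`a` part of `r • u_a` with `u_a` of degree `a`: only the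
  -- constant term of `r` survives.
  have hterm (a : ℕ) : f (GF.comp a (g (GM.comp a u))) =
      (C (constantCoeff r) : MvPolynomial σ k) • GM.comp a u := by
    rw [hf, h, GM.comp_smul_of_comp_eq (d := a) (by simp [GM.comp_comp]), shift_comp_self]
  simp only [hterm]
  rw [← smul_sum, h₂ (max N₁ N₂) (by omega), ← mul_smul, ← C_mul, inv_mul_cancel₀ hr, C_1,
    one_smul]

end MvPolynomial.Grading

end Gradings

/-! ### Auslander–Buchsbaum for graded modules -/

section AuslanderBuchsbaum

open MvPolynomial RingTheory.Sequence CategoryTheory Abelian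

variable {k : Type u} [Field k] {n : ℕ}

variable (k n) in
/-- The residue field of `k[x_1, …, x_n]` at the irrelevant ideal, as a module. -/
noncomputable abbrev MvPolynomial.residueModule : ModuleCat.{u} (MvPolynomial (Fin n) k) :=
  ModuleCat.of _ (MvPolynomial (Fin n) k ⧸ idealOfVars (Fin n) k)

lemma MvPolynomial.support_residueModule :
    Module.support (MvPolynomial (Fin n) k) (residueModule k n) =
      PrimeSpectrum.zeroLocus (idealOfVars (Fin n) k) := by
  rw [Module.support_eq_zeroLocus, Ideal.annihilator_quotient]

/-- The variables form a regular sequence of length `n` on a nonzero free module. Rank zero is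
separate because regularity demands a proper quotient. -/
lemma MvPolynomial.subsingleton_ext_free (s i : ℕ) (hi : i < n) :
    Subsingleton (Ext (residueModule k n)
      (ModuleCat.of _ (Fin s → MvPolynomial (Fin n) k)) i) := by
  cases s with
  | zero =>
    have hz : Limits.IsZero (ModuleCat.of (MvPolynomial (Fin n) k)
        (Fin 0 → MvPolynomial (Fin n) k)) := ModuleCat.isZero_of_subsingleton _
    refine ⟨fun a b => ?_⟩
    rw [← a.comp_mk₀_id, ← b.comp_mk₀_id, hz.eq_of_src (𝟙 _) 0]
    simp
  | succ s =>
    have hne : idealOfVars (Fin n) k •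
        (⊤ : Submodule (MvPolynomial (Fin n) k) (Fin (s + 1) → MvPolynomial (Fin n) k)) ≠ ⊤ := by
      intro h
      have h1 := congrArg (Submodule.map (LinearMap.proj 0)) h
      rw [Submodule.map_smul'', Submodule.map_top, LinearMap.range_eq_top.mpr
        (LinearMap.proj_surjective 0), smul_eq_mul, Ideal.mul_top] at h1
      exact isMaximal_idealOfVars.ne_top h1
    have hreg : IsWeaklyRegular (Fin (s + 1) → MvPolynomial (Fin n) k) (listX k n) :=
      ((TensorProduct.rid _ _).isWeaklyRegular_congr _).mp
        (isWeaklyRegular_listX.isWeaklyRegular_lTensor (M₂ := Fin (s + 1) → MvPolynomial (Fin n) k))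
    refine ModuleCat.subsingleton_ext_of_exists_isRegular (idealOfVars (Fin n) k)
      (residueModule k n) support_residueModule.subset (ModuleCat.of _ _) hne.lt_top (listX k n)
      (fun _ => listX_mem) ⟨hreg, ?_⟩ i (by rwa [length_listX])
    rw [ofList_listX]
    exact hne.symm

lemma MvPolynomial.subsingleton_ext_projective (P : ModuleCat.{u} (MvPolynomial (Fin n) k))
    [Module.Finite (MvPolynomial (Fin n) k) P] [Module.Projective (MvPolynomial (Fin n) k) P]
    (i : ℕ) (hi : i < n) : Subsingleton (Ext (residueModule k n) P i) := by
  obtain ⟨s, f, hf⟩ := Module.Finite.exists_fin' (MvPolynomial (Fin n) k) P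
  obtain ⟨g, hg⟩ := Module.projective_lifting_property f LinearMap.id hf
  have hgf : ModuleCat.ofHom g ≫ ModuleCat.ofHom f = 𝟙 P := by
    rw [← ModuleCat.ofHom_comp, hg]
    rfl
  have h0 := subsingleton_ext_free (k := k) s i hi
  refine ⟨fun a b => ?_⟩
  rw [← a.comp_mk₀_id, ← b.comp_mk₀_id, ← hgf, ← Ext.mk₀_comp_mk₀,
    ← Ext.comp_assoc_of_second_deg_zero, ← Ext.comp_assoc_of_second_deg_zero]
  congr 1
  exact Subsingleton.elim _ _

/-- Dimension shifting: for a free cover `F` with kernel `K`, `Ext^i(k, M)` lies between `Ext^i(k,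
F)` and `Ext^(i+1)(k, K)`. -/
lemma MvPolynomial.subsingleton_ext_of_hasProjectiveDimensionLE (p : ℕ)
    (M : ModuleCat.{u} (MvPolynomial (Fin n) k)) [Module.Finite (MvPolynomial (Fin n) k) M]
    (h : HasProjectiveDimensionLE M p) (i : ℕ) (hi : i + p < n) :
    Subsingleton (Ext (residueModule k n) M i) := by
  induction p generalizing M i with
  | zero =>
    have h1 : Projective M := (projective_iff_hasProjectiveDimensionLE_zero _).mpr h
    have : Module.Projective (MvPolynomial (Fin n) k) M := IsProjective.iff_projective _ |>.mpr h1
    exact subsingleton_ext_projective M i (by omega)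
  | succ p ih =>
    obtain ⟨s, f, hf⟩ := Module.Finite.exists_fin' (MvPolynomial (Fin n) k) M
    have hS := LinearMap.shortExact_shortComplexKer hf
    have hF : Projective f.shortComplexKer.X₂ :=
      IsProjective.iff_projective _ |>.mp inferInstance
    have hK := (hS.hasProjectiveDimensionLT_X₃_iff p hF).mp h
    have hK' := ih f.shortComplexKer.X₁ hK (i + 1) (by omega)
    have hF' := subsingleton_ext_free (k := k) (n := n) s i (by omega)
    have key (a : Ext (residueModule k n) f.shortComplexKer.X₃ i) : a = 0 := by
      obtain ⟨y, rfl⟩ := Ext.covariant_sequence_exact₃ _ hS a rfl (hK'.elim _ _)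
      rw [hF'.elim y 0, Ext.zero_comp]
    exact ⟨fun a b => (key a).trans (key b).symm⟩

lemma MvPolynomial.Grading.projective_of_subsingleton_ext
    (M : ModuleCat.{u} (MvPolynomial (Fin n) k)) [Module.Finite (MvPolynomial (Fin n) k) M]
    (G : Grading k (Fin n) M)
    (h : ∀ i < n, Subsingleton (Ext (residueModule k n) M i)) :
    Module.Projective (MvPolynomial (Fin n) k) M := by
  obtain ⟨ι, _, d, f, hf, hfG⟩ := G.exists_free_cover
  suffices ∃ r ∉ idealOfVars (Fin n) k, ∃ g : M →ₗ[MvPolynomial (Fin n) k] _,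
      f ∘ₗ g = r • LinearMap.id by
    obtain ⟨r, hr, g, hg⟩ := this
    exact (pi d).projective_of_comp_eq_smul G f hfG g r (mem_idealOfVars_iff.not.mp hr) hg
  -- If `𝔪M = M`, Nakayama gives `r ≡ 1` mod `𝔪` killing `M`, and `g = 0` works. Otherwise Rees
  -- gives a regular sequence of length `n`, so `M` is locally projective.
  by_cases hM : idealOfVars (Fin n) k • (⊤ : Submodule (MvPolynomial (Fin n) k) M) = ⊤
  · obtain ⟨r, hr, hr0⟩ := Submodule.exists_sub_one_mem_and_smul_eq_zero_of_fg_of_le_smul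
      (idealOfVars (Fin n) k) (⊤ : Submodule (MvPolynomial (Fin n) k) M) Module.Finite.fg_top hM.ge
    refine ⟨r, fun h => ?_, 0, ?_⟩
    · refine isMaximal_idealOfVars.ne_top ((Ideal.eq_top_iff_one (idealOfVars (Fin n) k)).mpr ?_)
      simpa using Ideal.sub_mem _ h hr
    · ext m
      simpa using (hr0 m trivial).symm
  · obtain ⟨rs, hlen, hmem, reg⟩ := ModuleCat.exists_isRegular_of_exists_subsingleton_ext
      (idealOfVars (Fin n) k) n M (lt_top_iff_ne_top.mpr hM) (residueModule k n)
      support_residueModule h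
    have := projective_localizedModule M rs hlen hmem reg.1
    have : Module.FinitePresentation (MvPolynomial (Fin n) k) M :=
      Module.finitePresentation_of_finite _ _
    exact Module.exists_comp_eq_smul_of_projective_localizedModule _ f hf

/-- Passing to the kernel `K` of a graded free cover gains one degree of vanishing: `Ext^i(k, K)`
lies between `Ext^(i-1)(k, M)` and `Ext^i(k, F)`. The kernel is again graded, so the induction
continues. -/
lemma MvPolynomial.Grading.hasProjectiveDimensionLE_of_subsingleton_ext (e : ℕ) (he : e ≤ n)
    (M : ModuleCat.{u} (MvPolynomial (Fin n) k)) [Module.Finite (MvPolynomial (Fin n) k) M]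
    (G : Grading k (Fin n) M)
    (h : ∀ i, i + e < n → Subsingleton (Ext (residueModule k n) M i)) :
    HasProjectiveDimensionLE M e := by
  induction e generalizing M with
  | zero =>
    have := G.projective_of_subsingleton_ext M h
    exact (projective_iff_hasProjectiveDimensionLE_zero _).mp
      (IsProjective.iff_projective _ |>.mp this)
  | succ e ih =>
    obtain ⟨ι, _, d, f, hf, hfG⟩ := G.exists_free_cover
    have hS := LinearMap.shortExact_shortComplexKer hf
    have hF : Projective f.shortComplexKer.X₂ :=
      IsProjective.iff_projective _ |>.mp inferInstance
    refine (hS.hasProjectiveDimensionLT_X₃_iff e hF).mpr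
      (ih (by omega) f.shortComplexKer.X₁ ((pi d).ker G f hfG) fun i hi => ?_)
    have hF' := subsingleton_ext_projective f.shortComplexKer.X₂ i (by omega)
    have key (a : Ext (residueModule k n) f.shortComplexKer.X₁ i) : a = 0 := by
      cases i with
      | zero =>
        have := hS.mono_f
        exact Ext.postcomp_mk₀_injective_of_mono _ f.shortComplexKer.f (hF'.elim _ _)
      | succ i =>
        obtain ⟨y, rfl⟩ := Ext.covariant_sequence_exact₁ _ hS a (hF'.elim _ _) rfl
        rw [(h i (by omega)).elim y 0, Ext.zero_comp]
    exact ⟨fun a b => (key a).trans (key b).symm⟩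

/-- The inequality form of the Auslander–Buchsbaum formula for graded modules over a polynomial
ring. -/
theorem MvPolynomial.Grading.projectiveDimension_le_iff
    (M : ModuleCat.{u} (MvPolynomial (Fin n) k)) [Module.Finite (MvPolynomial (Fin n) k) M]
    (G : Grading k (Fin n) M)
    (hM : idealOfVars (Fin n) k • (⊤ : Submodule (MvPolynomial (Fin n) k) M) ≠ ⊤)
    (e : ℕ) (he : e ≤ n) :
    projectiveDimension M ≤ e ↔ ((n - e : ℕ) : ℕ∞) ≤ moduleDepth (idealOfVars (Fin n) k) M := by
  rw [CategoryTheory.projectiveDimension_le_iff, moduleDepth, if_neg hM]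
  constructor
  · intro h
    obtain ⟨rs, hlen, hmem, reg⟩ := ModuleCat.exists_isRegular_of_exists_subsingleton_ext
      (idealOfVars (Fin n) k) (n - e) M (lt_top_iff_ne_top.mpr hM) (residueModule k n)
      support_residueModule
      fun i hi => subsingleton_ext_of_hasProjectiveDimensionLE e M h i (by omega)
    rw [← hlen]
    exact le_iSup (fun rs : {rs : List (MvPolynomial (Fin n) k) //
      (∀ r ∈ rs, r ∈ idealOfVars (Fin n) k) ∧ IsRegular M rs} => (rs.1.length : ℕ∞))
      ⟨rs, hmem, reg⟩
  · intro h
    refine G.hasProjectiveDimensionLE_of_subsingleton_ext e he M fun i hi => ?_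
    have hlt : (i : ℕ∞) < ((n - e : ℕ) : ℕ∞) := by
      rw [Nat.cast_lt]
      omega
    obtain ⟨⟨rs, hmem, reg⟩, hrs⟩ := lt_iSup_iff.mp (hlt.trans_le h)
    exact ModuleCat.subsingleton_ext_of_exists_isRegular (idealOfVars (Fin n) k)
      (residueModule k n) support_residueModule.subset M (lt_top_iff_ne_top.mpr hM) rs hmem reg i
      (Nat.cast_lt.mp hrs)

end AuslanderBuchsbaum

/-! ### Height and dimension of monomial ideals -/

section Dimension

open MvPolynomial

variable {k : Type u} [Field k] {n : ℕ}

variable (k) in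
/-- The monomial prime ideal generated by the variables indexed by `F`. -/
noncomputable def MvPolynomial.varIdeal (F : Finset (Fin n)) : Ideal (MvPolynomial (Fin n) k) :=
  Ideal.span (X '' (F : Set (Fin n)))

open Classical in
-- Setting the variables of `F` to zero changes a polynomial only by an element of the ideal. As a
-- kernel into a domain, the ideal is prime.
lemma MvPolynomial.ker_aeval_eq_varIdeal (F : Finset (Fin n)) :
    RingHom.ker (aeval (R := k) (fun i => if i ∈ F then (0 : MvPolynomial (Fin n) k) else X i)) =
      varIdeal k F := by
  set φ := aeval (R := k) (fun i => if i ∈ F then (0 : MvPolynomial (Fin n) k) else X i) with hφ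
  apply le_antisymm
  · have key (p : MvPolynomial (Fin n) k) : p - φ p ∈ varIdeal k F := by
      induction p using MvPolynomial.induction_on with
      | C c => simp [hφ]
      | add p q hp hq =>
        rw [map_add, add_sub_add_comm]
        exact Ideal.add_mem _ hp hq
      | mul_X p i hp =>
        by_cases hi : i ∈ F
        · have h0 : φ (X i) = 0 := by simp [hφ, hi]
          rw [map_mul, h0, mul_zero, sub_zero]
          exact Ideal.mul_mem_left _ _ (Ideal.subset_span ⟨i, hi, rfl⟩)
        · have h0 : φ (X i) = X i := by simp [hφ, hi]
          rw [map_mul, h0, ← sub_mul]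
          exact Ideal.mul_mem_right _ _ hp
    intro p hp
    have := key p
    rwa [(RingHom.mem_ker).mp hp, sub_zero] at this
  · rw [varIdeal, Ideal.span_le]
    rintro _ ⟨i, hi, rfl⟩
    have hi' : i ∈ F := hi
    simp [hφ, RingHom.mem_ker, hi']

instance MvPolynomial.isPrime_varIdeal (F : Finset (Fin n)) : (varIdeal k F).IsPrime := by
  classical
  rw [← ker_aeval_eq_varIdeal]
  exact RingHom.ker_isPrime _

lemma MvPolynomial.X_mem_varIdeal_iff {F : Finset (Fin n)} {i : Fin n} :
    X i ∈ varIdeal k F ↔ i ∈ F := by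
  classical
  rw [← ker_aeval_eq_varIdeal, RingHom.mem_ker]
  simp [X_ne_zero]

lemma MvPolynomial.card_le_height_varIdeal (F : Finset (Fin n)) :
    (F.card : ℕ∞) ≤ (varIdeal k F).height := by
  classical
  induction F using Finset.induction_on with
  | empty => simp
  | insert i F hi ih =>
    rw [Finset.card_insert_of_notMem hi, Nat.cast_add, Nat.cast_one]
    refine (add_le_add_left ih 1).trans (Ideal.height_add_one_le_of_lt_of_isPrime ?_)
    refine lt_of_le_of_ne (Ideal.span_mono (Set.image_mono (by simp))) fun h => hi ?_
    rw [← X_mem_varIdeal_iff (k := k), h, X_mem_varIdeal_iff]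
    exact Finset.mem_insert_self _ _

lemma MvPolynomial.height_varIdeal_le (F : Finset (Fin n)) :
    (varIdeal k F).height ≤ (F.card : ℕ∞) := by
  refine (Ideal.height_le_spanFinrank _ (isPrime_varIdeal F).ne_top).trans ?_
  refine (Submodule.spanFinrank_span_le_encard _).trans ?_
  exact (Set.encard_image_le _ _).trans (by simp)

lemma MvPolynomial.varIdeal_univ :
    varIdeal k (Finset.univ : Finset (Fin n)) = idealOfVars (Fin n) k := by
  simp [varIdeal, idealOfVars]

/-- The irrelevant ideal has height at least `n`, and killing `F.card` of its elements costs at most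
`F.card` in dimension. -/
lemma MvPolynomial.le_ringKrullDim_quotient_varIdeal_add (F : Finset (Fin n)) :
    (n : WithBot ℕ∞) ≤ ringKrullDim (MvPolynomial (Fin n) k ⧸ varIdeal k F) + F.card := by
  have h1 := card_le_height_varIdeal (k := k) (Finset.univ : Finset (Fin n))
  rw [varIdeal_univ, Finset.card_univ, Fintype.card_fin] at h1
  have h2 := Ideal.height_le_ringKrullDim_quotient_add_encard (p := idealOfVars (Fin n) k)
    (X '' (F : Set (Fin n))) (by
      rintro _ ⟨i, -, rfl⟩
      exact Ideal.subset_span ⟨i, rfl⟩)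
  have h3 : ((X '' (F : Set (Fin n)) : Set (MvPolynomial (Fin n) k)).encard) ≤ F.card :=
    (Set.encard_image_le _ _).trans (by simp)
  calc (n : WithBot ℕ∞) = ((n : ℕ∞) : WithBot ℕ∞) := rfl
    _ ≤ _ := WithBot.coe_le_coe.mpr h1
    _ ≤ _ := h2
    _ ≤ _ := add_le_add_right (WithBot.coe_le_coe.mpr h3) _

/-- A prime ideal containing a monomial ideal contains a monomial prime ideal containing it. -/
lemma IsMonomialIdeal.exists_varIdeal {I : Ideal (MvPolynomial (Fin n) k)}
    (hI : IsMonomialIdeal I) (P : Ideal (MvPolynomial (Fin n) k)) [P.IsPrime] (hP : I ≤ P) :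
    ∃ F : Finset (Fin n), I ≤ varIdeal k F ∧ varIdeal k F ≤ P := by
  classical
  obtain ⟨S, rfl⟩ := hI
  -- A monomial lies in the prime `P` only if one of the variables dividing it does.
  refine ⟨Finset.univ.filter fun i => X i ∈ P, ?_, ?_⟩
  · rw [Ideal.span_le]
    rintro _ ⟨a, ha, rfl⟩
    have hmem : monomial a (1 : k) ∈ P := hP (Ideal.subset_span ⟨a, ha, rfl⟩)
    rw [monomial_eq, C_1, one_mul, Finsupp.prod, Ideal.IsPrime.prod_mem_iff] at hmem
    obtain ⟨i, hi, hiP⟩ := hmem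
    change monomial a (1 : k) ∈ _
    rw [monomial_eq, C_1, one_mul, Finsupp.prod]
    refine Ideal.IsPrime.prod_mem_iff.mpr ⟨i, hi, Ideal.pow_mem_of_mem _ ?_ _ ?_⟩
    · rw [X_mem_varIdeal_iff]
      simpa using Ideal.IsPrime.mem_of_pow_mem inferInstance _ hiP
    · exact Nat.pos_of_ne_zero (Finsupp.mem_support_iff.mp hi)
  · rw [varIdeal, Ideal.span_le]
    rintro _ ⟨i, hi, rfl⟩
    simpa using hi

/-- A chain of primes going up from `P ⊇ I` can be prolonged by a chain below `P`: height plus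
coheight is at most the dimension. -/
lemma Ideal.ringKrullDim_quotient_add_le {R : Type*} [CommRing R] [Nontrivial R] (I : Ideal R)
    (h : ℕ∞) (hI : ∀ P : Ideal R, P.IsPrime → I ≤ P → h ≤ P.height) :
    ringKrullDim (R ⧸ I) + h ≤ ringKrullDim R := by
  rcases eq_or_ne I ⊤ with rfl | hne
  · have : Subsingleton (R ⧸ (⊤ : Ideal R)) := Ideal.Quotient.subsingleton_iff.mpr rfl
    simp [ringKrullDim_eq_bot_of_subsingleton]
  have : Nontrivial (R ⧸ I) := Ideal.Quotient.nontrivial_iff.mpr hne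
  rw [ringKrullDim_quotient]
  have : Nonempty (PrimeSpectrum.zeroLocus (R := R) I) := by
    rwa [Set.nonempty_coe_sort, Set.nonempty_iff_ne_empty, ne_eq,
      PrimeSpectrum.zeroLocus_empty_iff_eq_top]
  rw [Order.krullDim_eq_iSup_coheight_of_nonempty, ringKrullDim,
    Order.krullDim_eq_iSup_height_add_coheight_of_nonempty, ← WithBot.coe_add, ENat.iSup_add,
    WithBot.coe_le_coe]
  refine iSup_le fun p => ?_
  rw [add_comm]
  refine le_trans (add_le_add ?_ ?_)
    (le_iSup (fun a : PrimeSpectrum R => Order.height a + Order.coheight a) p.1)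
  · rw [← PrimeSpectrum.height_eq_orderHeight]
    exact hI _ p.1.2 p.2
  · exact Order.coheight_le_coheight_apply_of_strictMono Subtype.val (fun _ _ h => h) p

/-- For a proper monomial ideal, height and dimension of the quotient add up to `n`. -/
lemma IsMonomialIdeal.exists_height_eq {I : Ideal (MvPolynomial (Fin n) k)}
    (hI : IsMonomialIdeal I) (hne : I ≠ ⊤) :
    ∃ h d : ℕ, h + d = n ∧ I.height = h ∧ ringKrullDim (MvPolynomial (Fin n) k ⧸ I) = d := by
  classical
  obtain ⟨P, hPmax, hIP⟩ := Ideal.exists_le_maximal I hne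
  obtain ⟨F₀, hF₀, -⟩ := hI.exists_varIdeal P hIP
  -- A smallest set of variables whose ideal contains `I`; by minimality every prime over `I` has
  -- height at least `F.card`.
  obtain ⟨F, hF, hmin⟩ := Finset.exists_min_image
    (Finset.univ.filter fun F : Finset (Fin n) => I ≤ varIdeal k F) Finset.card
    ⟨F₀, by simpa using hF₀⟩
  simp only [Finset.mem_filter, Finset.mem_univ, true_and] at hF hmin
  have hle (Q : Ideal (MvPolynomial (Fin n) k)) (hQ : Q.IsPrime) (hIQ : I ≤ Q) :
      (F.card : ℕ∞) ≤ Q.height := by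
    obtain ⟨G, hG, hGQ⟩ := hI.exists_varIdeal Q hIQ
    exact (Nat.cast_le.mpr (hmin G hG)).trans
      ((card_le_height_varIdeal G).trans (Ideal.height_mono hGQ))
  have hcard : F.card ≤ n := by simpa using Finset.card_le_univ F
  refine ⟨F.card, n - F.card, by omega, le_antisymm ?_ ?_, ?_⟩
  · exact (Ideal.height_mono hF).trans (height_varIdeal_le F)
  · rw [Ideal.height_eq_inf_minimalPrimes]
    exact le_iInf₂ fun J hJ => hle J hJ.1.1 hJ.1.2
  · have h1 := Ideal.ringKrullDim_quotient_add_le I F.card hle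
    rw [MvPolynomial.ringKrullDim_of_isNoetherianRing, ringKrullDim_eq_zero_of_field, zero_add,
      Nat.card_eq_fintype_card, Fintype.card_fin] at h1
    have h2 := le_ringKrullDim_quotient_varIdeal_add (k := k) F
    have h3 : ringKrullDim (MvPolynomial (Fin n) k ⧸ varIdeal k F) ≤
        ringKrullDim (MvPolynomial (Fin n) k ⧸ I) :=
      ringKrullDim_le_of_surjective (Ideal.Quotient.factor hF) (Ideal.Quotient.factor_surjective hF)
    have h4 : ((n - F.card : ℕ) : WithBot ℕ∞) + (F.card : ℕ) = n := by
      rw [← Nat.cast_add, Nat.sub_add_cancel hcard]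
    apply le_antisymm
    · rw [← ENat.WithBot.add_le_add_natCast_right_iff (c := F.card), h4]
      exact h1
    · rw [← ENat.WithBot.add_le_add_natCast_right_iff (c := F.card), h4]
      exact h2.trans (add_le_add_left h3 _)

end Dimension

/-! ### The grading of a monomial quotient -/

section MonomialQuotient

open MvPolynomial

variable {k : Type u} [Field k] {n : ℕ}

/-- The grading of the quotient of a graded module by a graded submodule. -/
noncomputable def MvPolynomial.Grading.quotient {σ M : Type*} [AddCommGroup M]
    [Module (MvPolynomial σ k) M] (G : Grading k σ M) (N : Submodule (MvPolynomial σ k) M)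
    (hN : ∀ a, ∀ m ∈ N, G.comp a m ∈ N) : Grading k σ (M ⧸ N) where
  comp a := QuotientAddGroup.map N.toAddSubgroup N.toAddSubgroup (G.comp a) (hN a)
  comp_comp a b m := by
    obtain ⟨m, rfl⟩ := N.mkQ_surjective m
    have h := congrArg N.mkQ (G.comp_comp a b m)
    rw [apply_ite N.mkQ, map_zero] at h
    exact h
  exists_sum m := by
    obtain ⟨m, rfl⟩ := N.mkQ_surjective m
    obtain ⟨A, hA⟩ := G.exists_sum m
    refine ⟨A, fun A' hA' => ?_⟩
    have h := congrArg N.mkQ (hA A' hA')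
    rw [map_sum] at h
    exact h
  comp_C a c m := by
    obtain ⟨m, rfl⟩ := N.mkQ_surjective m
    exact congrArg N.mkQ (G.comp_C a c m)
  comp_succ_X a i m := by
    obtain ⟨m, rfl⟩ := N.mkQ_surjective m
    exact congrArg N.mkQ (G.comp_succ_X a i m)
  comp_zero_X i m := by
    obtain ⟨m, rfl⟩ := N.mkQ_surjective m
    exact congrArg N.mkQ (G.comp_zero_X i m)

/-- Membership in a monomial ideal is tested monomial by monomial, and a homogeneous component has a
smaller support. -/
lemma IsMonomialIdeal.comp_mem {I : Ideal (MvPolynomial (Fin n) k)} (hI : IsMonomialIdeal I)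
    (a : ℕ) (p : MvPolynomial (Fin n) k) (hp : p ∈ I) :
    (Grading.shift k (Fin n) 0).comp a p ∈ I := by
  obtain ⟨S, rfl⟩ := hI
  rw [mem_ideal_span_monomial_image] at hp ⊢
  intro m hm
  refine hp m ?_
  simp only [Grading.shift, zero_le, if_true, tsub_zero, LinearMap.toAddMonoidHom_coe,
    mem_support_iff, coeff_homogeneousComponent] at hm ⊢
  exact fun h => hm (by simp [h])

lemma IsMonomialIdeal.le_idealOfVars {I : Ideal (MvPolynomial (Fin n) k)} (hI : IsMonomialIdeal I)
    (hne : I ≠ ⊤) : I ≤ idealOfVars (Fin n) k := by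
  obtain ⟨P, hPmax, hIP⟩ := Ideal.exists_le_maximal I hne
  obtain ⟨F, hF, -⟩ := hI.exists_varIdeal P hIP
  refine hF.trans (Ideal.span_mono ?_)
  exact Set.image_subset_range _ _

end MonomialQuotient

theorem mainTheorem6 {k : Type*} [Field k] {n : ℕ} (I : Ideal (MvPolynomial (Fin n) k))
    (hI : IsMonomialIdeal I) :
    IsAlmostCohenMacaulay I ↔
      CategoryTheory.projectiveDimension
          (ModuleCat.of (MvPolynomial (Fin n) k) (MvPolynomial (Fin n) k ⧸ I)) ≤
        (I.height : WithBot ℕ∞) + 1 := by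
  rw [IsAlmostCohenMacaulay]
  rcases eq_or_ne I ⊤ with rfl | hne
  · have : Subsingleton (MvPolynomial (Fin n) k ⧸ (⊤ : Ideal (MvPolynomial (Fin n) k))) :=
      Ideal.Quotient.subsingleton_iff.mpr rfl
    rw [ringKrullDim_eq_bot_of_subsingleton, (CategoryTheory.projectiveDimension_eq_bot_iff _).mpr
      (ModuleCat.isZero_of_subsingleton _)]
    simp
  obtain ⟨h, d, hd, hht, hdim⟩ := hI.exists_height_eq hne
  have hM : MvPolynomial.idealOfVars (Fin n) k •
      (⊤ : Submodule (MvPolynomial (Fin n) k) (MvPolynomial (Fin n) k ⧸ I)) ≠ ⊤ := by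
    intro htop
    have h1 := congrArg (Submodule.comap (Submodule.mkQ I)) htop
    rw [Submodule.comap_smul_top_of_surjective _ _ (Submodule.mkQ_surjective _),
      Submodule.comap_top, Submodule.ker_mkQ, smul_eq_mul, Ideal.mul_top,
      sup_eq_left.mpr (hI.le_idealOfVars hne)] at h1
    exact MvPolynomial.isMaximal_idealOfVars.ne_top h1
  have key := ((MvPolynomial.Grading.shift k (Fin n) 0).quotient I
    hI.comp_mem).projectiveDimension_le_iff (ModuleCat.of _ (MvPolynomial (Fin n) k ⧸ I)) hM
  rw [hht, hdim]
  generalize MvPolynomial.idealOfVars (Fin n) k = m at key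
  set δ := moduleDepth m (MvPolynomial (Fin n) k ⧸ I)
  -- Since `h + d = n`, the truncated `n - (h + 1)` is `d - 1`, or `0` if `d = 0`.
  have hl : (d : WithBot ℕ∞) ≤ (δ : WithBot ℕ∞) + 1 ↔ ((n - (h + 1) : ℕ) : ℕ∞) ≤ δ := by
    have : (d : WithBot ℕ∞) ≤ (δ : WithBot ℕ∞) + 1 ↔ (d : ℕ∞) ≤ δ + 1 :=
      WithBot.coe_le_coe (a := (d : ℕ∞)) (b := δ + 1)
    rw [this]
    induction δ using ENat.recTopCoe with
    | top => simp
    | coe δ =>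
      norm_cast
      omega
  have hr : ((h : ℕ∞) : WithBot ℕ∞) + 1 = ((h + 1 : ℕ) : WithBot ℕ∞) := rfl
  rw [hl, hr]
  rcases le_or_gt (h + 1) n with hn | hn
  · exact (key (h + 1) hn).symm
  -- Here `h = n`, outside the range of `key (h + 1)`, and both sides hold: depth is nonnegative,
  -- and `e = n` gives `pd ≤ n` as in Hilbert's syzygy theorem.
  · have hpd := (key n le_rfl).mpr (by simp)
    have h0 : n - (h + 1) = 0 := by omega
    refine iff_of_true (by simp [h0]) (hpd.trans ?_)
    exact_mod_cast hn.le
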